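/- Let $G$ be a group. Let $\mathcal{L}_G$ denote the lattice of all (not necessarily Hausdorff) group topologies on $G$, ordered by inclusion: $\tau\le\sigma$ if and only if $\sigma$ is finer than $\tau$. In a lattice, write $b\prec a$ if $b<a$ and there is no $c$ with $b<c<a$, and write $b\preceq a$ if $b\prec a$ or $b=a$. A lattice is called semi-modular if it satisfies the upper covering condition: whenever $b\prec a$, one has $b\vee c\preceq a\vee c$ for every element $c$ of the lattice. Let $N$ be a central subgroup of $G$, i.e. a subgroup contained in the centre of $G$. Then $\mathcal{L}_G$ is semi-modular if and only if $\mathcal{L}_{G/N}$ is semi-modular. -/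

import Mathlib

/-- The lattice of all (not necessarily Hausdorff) group topologies on `G`, ordered by inclusion of
the families of open sets: `τ ≤ σ` iff `σ` is finer than `τ`.  Mathlib's order on `GroupTopology G`
is the reverse one, hence the order dual. -/
abbrev GroupTopologyLattice (G : Type*) [Group G] : Type _ := (GroupTopology G)ᵒᵈ

/-- The order is inclusion of the families of open sets. -/
theorem GroupTopologyLattice.le_iff {G : Type*} [Group G] (τ σ : GroupTopologyLattice G) :
    τ ≤ σ ↔ ∀ U : Set G, (OrderDual.ofDual τ).IsOpen U →
      (OrderDual.ofDual σ).IsOpen U :=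
  Iff.rfl

/-- A lattice is (upper) semi-modular if it satisfies the upper covering condition: whenever `a`
covers `b`, for every `c` the element `a ⊔ c` covers or equals `b ⊔ c`. -/
def IsSemimodularLattice (L : Type*) [Lattice L] : Prop :=
  ∀ a b : L, b ⋖ a → ∀ c : L, b ⊔ c ⋖ a ⊔ c ∨ b ⊔ c = a ⊔ c

/-- A central subgroup is normal (needed to speak of the quotient group). -/
theorem Subgroup.normal_of_central {G : Type*} [Group G] {N : Subgroup G}
    (hN : N ≤ Subgroup.center G) : N.Normal where
  conj_mem n hn g := by
    rw [Subgroup.mem_center_iff.mp (hN hn) g, mul_inv_cancel_right]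
    exact hn

/-! ### Covering conditions in abstract lattices. -/

section Lattice

variable {L L' : Type*} [Lattice L] [Lattice L']

/-! Let `M` be the topology with least neighbourhood `N`. Pulling back along `G → G ⧸ N` identifies
the topologies on the quotient with the ideal below `M`, and semi-modularity restricts to ideals.
Conversely (`isSemimodularLattice_of_Iic`), a covering `b ⋖ a` is either visible below `M`, where
the hypothesis applies and the result is lifted by cancellation, or satisfies `a ⊓ M ≤ b`. Only the
latter case needs centrality: the relevant neighbourhood filters then commute, so meets are given by
products of neighbourhoods and a modular law holds (`sup_inf_le_of_le_center`). -/

theorem isSemimodularLattice_iff_wcovBy :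
    IsSemimodularLattice L ↔ ∀ a b : L, b ⋖ a → ∀ c : L, b ⊔ c ⩿ a ⊔ c := by
  simp only [IsSemimodularLattice, wcovBy_iff_covBy_or_eq]

/-- Semi-modularity of a lattice that embeds as a principal ideal, in terms of the big lattice. -/
theorem isSemimodularLattice_iff_of_range_eq_Iic (f : L' ↪o L) {M : L}
    (hf : Set.range f = Set.Iic M) :
    IsSemimodularLattice L' ↔
      ∀ a b c : L, a ≤ M → b ≤ M → c ≤ M → b ⋖ a → b ⊔ c ⩿ a ⊔ c := by
  have hconn : (Set.range f).OrdConnected := hf ▸ Set.ordConnected_Iic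
  have hle (x : L') : f x ≤ M := hf.subset ⟨x, rfl⟩
  have hsurj {y : L} (hy : y ≤ M) : ∃ x, f x = y := hf.superset hy
  have hsup (x y : L') : f (x ⊔ y) = f x ⊔ f y := by
    obtain ⟨z, hz⟩ := hsurj (sup_le (hle x) (hle y))
    refine le_antisymm ?_ (sup_le (f.monotone le_sup_left) (f.monotone le_sup_right))
    rw [← hz, f.le_iff_le]
    exact sup_le (f.le_iff_le.1 (hz ▸ le_sup_left)) (f.le_iff_le.1 (hz ▸ le_sup_right))
  rw [isSemimodularLattice_iff_wcovBy]
  constructor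
  · intro h a b c ha hb hc hba
    obtain ⟨a, rfl⟩ := hsurj ha
    obtain ⟨b, rfl⟩ := hsurj hb
    obtain ⟨c, rfl⟩ := hsurj hc
    rw [← hsup, ← hsup, hconn.apply_wcovBy_apply_iff f]
    exact h a b ((hconn.apply_covBy_apply_iff f).1 hba) c
  · intro h a b hba c
    rw [← hconn.apply_wcovBy_apply_iff f, hsup, hsup]
    exact h _ _ _ (hle a) (hle b) (hle c) ((hconn.apply_covBy_apply_iff f).2 hba)

/-- Semi-modularity passes from the principal ideal of `M` to the whole lattice, if `M` satisfies
suitable cancellation and modularity laws. -/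
theorem isSemimodularLattice_of_Iic {M : L}
    (hcancel : ∀ x y : L, x ≤ y → y ⊓ M ≤ x → y ≤ x ⊔ M → y ≤ x)
    (hmod : ∀ x d : L, d ≤ M → (x ⊔ d) ⊓ M ≤ (x ⊓ M) ⊔ d)
    (hmod' : ∀ a y c : L, a ⊓ M ≤ y → c ≤ y → y ≤ a ⊔ c → y ≤ (y ⊓ a) ⊔ c)
    (h : ∀ a b c : L, a ≤ M → b ≤ M → c ≤ M → b ⋖ a → b ⊔ c ⩿ a ⊔ c) :
    IsSemimodularLattice L := by
  rw [isSemimodularLattice_iff_wcovBy]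
  intro a b hba c
  refine ⟨sup_le_sup_right hba.le c, fun y hy hy' => ?_⟩
  by_cases hab : a ⊓ M ≤ b
  · have hby : b ≤ y := le_sup_left.trans hy.le
    have hcy : c ≤ y := le_sup_right.trans hy.le
    have key := hmod' a y c (hab.trans hby) hcy hy'.le
    rcases hba.eq_or_eq (le_inf hby hba.le) inf_le_right with e | e
    · exact hy.not_ge (e ▸ key)
    · exact hy'.not_ge (sup_le (inf_eq_right.1 e) hcy)
  · have ha : b ⊔ (a ⊓ M) = a :=
      (hba.eq_or_eq le_sup_left (sup_le hba.le inf_le_left)).resolve_left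
        fun e => hab (e ▸ le_sup_right)
    have hcov : b ⊓ M ⋖ a ⊓ M := by
      refine ⟨lt_of_le_of_ne (inf_le_inf_right M hba.le)
        fun e => hab (e ▸ inf_le_left), fun d hd hd' => ?_⟩
      have hdM : d ≤ M := hd'.le.trans inf_le_right
      rcases hba.eq_or_eq (le_sup_left (a := b) (b := d))
        (sup_le hba.le (hd'.le.trans inf_le_left)) with e | e
      · exact hd.not_ge (le_inf (e ▸ le_sup_right) hdM)
      · refine hd'.not_ge ?_
        have := hmod b d hdM
        rw [e] at this
        exact this.trans (sup_le hd.le le_rfl)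
    -- Using `(b ⊔ c) ⊓ M` rather than `c ⊓ M` makes the lower end of the interval exactly the trace
    -- of `b ⊔ c`.
    have hw := h (a ⊓ M) (b ⊓ M) ((b ⊔ c) ⊓ M) inf_le_right inf_le_right inf_le_right hcov
    rw [sup_eq_right.2 (inf_le_inf_right M le_sup_left)] at hw
    set x := b ⊔ c
    set f := a ⊓ M ⊔ x ⊓ M
    have hfM : f ≤ M := sup_le inf_le_right inf_le_right
    have hac : a ⊔ c ≤ x ⊔ f := by
      refine sup_le ?_ (le_sup_right.trans le_sup_left)
      rw [← ha]
      exact sup_le_sup le_sup_left le_sup_left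
    have hyM : y ⊓ M ≤ f :=
      (inf_le_inf_right M (hy'.le.trans hac)).trans
        ((hmod x f hfM).trans (sup_le le_sup_right le_rfl))
    rcases hw.eq_or_eq (inf_le_inf_right M hy.le) hyM with e | e
    · exact hy.not_ge (hcancel x y hy.le (e ▸ inf_le_left)
        ((hy'.le.trans hac).trans (sup_le_sup_left hfM x)))
    · exact hy'.not_ge (hac.trans (sup_le hy.le (e ▸ inf_le_left)))

end Lattice

/-! ### Group topologies through their neighbourhood filters at `1`. -/

namespace GroupTopology

open Filter
open scoped Topology Pointwise

variable {G : Type*} [Group G]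

/-- The neighbourhood filter of the identity. -/
def nhdsOne (t : GroupTopology G) : Filter G := @nhds G t.toTopologicalSpace 1

theorem one_le_nhdsOne (t : GroupTopology G) : 1 ≤ t.nhdsOne :=
  @pure_le_nhds G t.toTopologicalSpace 1

theorem nhdsOne_mul_nhdsOne (t : GroupTopology G) : t.nhdsOne * t.nhdsOne ≤ t.nhdsOne := by
  let := t.toTopologicalSpace
  have := t.toIsTopologicalGroup
  have h : Tendsto (fun p : G × G => p.1 * p.2) (𝓝 1 ×ˢ 𝓝 1) (𝓝 1) := by
    simpa [nhds_prod_eq] using (continuous_mul (M := G)).tendsto (1, 1)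
  exact map₂_mul.symm.trans_le ((map_prod_eq_map₂ (· * ·) _ _).symm.trans_le h)

theorem inv_nhdsOne (t : GroupTopology G) : t.nhdsOne⁻¹ = t.nhdsOne := by
  let := t.toTopologicalSpace
  have := t.toIsTopologicalGroup
  exact (Filter.comap_inv).symm.trans (nhds_one_symm G)

theorem map_conj_nhdsOne (t : GroupTopology G) (g : G) :
    map (MulAut.conj g) t.nhdsOne ≤ t.nhdsOne := by
  let := t.toTopologicalSpace
  have := t.toIsTopologicalGroup
  have h : Continuous fun x : G => g * x * g⁻¹ := by fun_prop
  simpa using! h.tendsto 1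

theorem nhdsOne_le_iff {s t : GroupTopology G} : s.nhdsOne ≤ t.nhdsOne ↔ s ≤ t := by
  refine ⟨fun h => ?_, fun h => nhds_mono h⟩
  rw [← toTopologicalSpace_le, le_iff_nhds]
  intro x
  have key (r : GroupTopology G) : map (x * ·) r.nhdsOne = @nhds G r.toTopologicalSpace x := by
    let := r.toTopologicalSpace
    have := r.toIsTopologicalGroup
    exact map_mul_left_nhds_one x
  rw [← key, ← key]
  exact map_mono h

theorem nhdsOne_inf (s t : GroupTopology G) : (s ⊓ t).nhdsOne = s.nhdsOne ⊓ t.nhdsOne :=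
  nhds_inf

theorem exists_nhdsOne_eq {F : Filter G} (hone : 1 ≤ F) (hmul : F * F ≤ F) (hinv : F⁻¹ ≤ F)
    (hconj : ∀ g : G, map (MulAut.conj g) F ≤ F) : ∃ t : GroupTopology G, t.nhdsOne = F := by
  let B : GroupFilterBasis G :=
    { sets := F.sets
      nonempty := ⟨_, univ_mem⟩
      inter_sets := fun hU hV => ⟨_, inter_mem hU hV, subset_rfl⟩
      one' := fun hU => hone hU
      mul' := fun hU => by
        obtain ⟨V, hV, W, hW, h⟩ := mem_mul.1 (hmul hU)
        exact ⟨V ∩ W, inter_mem hV hW,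
          (Set.mul_subset_mul Set.inter_subset_left Set.inter_subset_right).trans h⟩
      inv' := fun hU => ⟨_, hinv hU, subset_rfl⟩
      conj' := fun g _ hU => ⟨_, hconj g hU, subset_rfl⟩ }
  refine ⟨⟨B.topology, B.isTopologicalGroup⟩, ?_⟩
  refine B.nhds_one_eq.trans (Filter.ext fun U => ?_)
  rw [FilterBasis.mem_filter_iff]
  exact ⟨fun ⟨V, hV, h⟩ => mem_of_superset hV h, fun hU => ⟨U, hU, subset_rfl⟩⟩

/-- If the neighbourhood filters commute, their product is the neighbourhood filter of the finest
group topology coarser than both. -/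
theorem nhdsOne_sup {s t : GroupTopology G}
    (h : t.nhdsOne * s.nhdsOne ≤ s.nhdsOne * t.nhdsOne) :
    (s ⊔ t).nhdsOne = s.nhdsOne * t.nhdsOne := by
  obtain ⟨r, hr⟩ : ∃ r : GroupTopology G, r.nhdsOne = s.nhdsOne * t.nhdsOne := by
    refine exists_nhdsOne_eq ?_ ?_ ?_ ?_
    · simpa using mul_le_mul' s.one_le_nhdsOne t.one_le_nhdsOne
    · calc s.nhdsOne * t.nhdsOne * (s.nhdsOne * t.nhdsOne)
          = s.nhdsOne * (t.nhdsOne * s.nhdsOne) * t.nhdsOne := by simp only [mul_assoc]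
        _ ≤ s.nhdsOne * (s.nhdsOne * t.nhdsOne) * t.nhdsOne := by gcongr
        _ = (s.nhdsOne * s.nhdsOne) * (t.nhdsOne * t.nhdsOne) := by simp only [mul_assoc]
        _ ≤ s.nhdsOne * t.nhdsOne := mul_le_mul' s.nhdsOne_mul_nhdsOne t.nhdsOne_mul_nhdsOne
    · rw [mul_inv_rev, s.inv_nhdsOne, t.inv_nhdsOne]
      exact h
    · intro g
      rw [Filter.map_mul]
      exact mul_le_mul' (s.map_conj_nhdsOne g) (t.map_conj_nhdsOne g)
  refine le_antisymm ?_ ?_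
  · rw [← hr, nhdsOne_le_iff]
    refine sup_le (nhdsOne_le_iff.1 ?_) (nhdsOne_le_iff.1 ?_) <;> rw [hr]
    · simpa using mul_le_mul' (le_refl s.nhdsOne) t.one_le_nhdsOne
    · simpa using mul_le_mul' s.one_le_nhdsOne (le_refl t.nhdsOne)
  · exact (mul_le_mul' (nhdsOne_le_iff.2 le_sup_left) (nhdsOne_le_iff.2 le_sup_right)).trans
      (s ⊔ t).nhdsOne_mul_nhdsOne

theorem exists_mul_subset {t : GroupTopology G} {U : Set G} (hU : U ∈ t.nhdsOne) :
    ∃ V ∈ t.nhdsOne, V⁻¹ = V ∧ V * V ⊆ U := by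
  obtain ⟨V, hV, W, hW, h⟩ := mem_mul.1 (t.nhdsOne_mul_nhdsOne hU)
  have hVW := inter_mem hV hW
  refine ⟨V ∩ W ∩ (V ∩ W)⁻¹, inter_mem hVW ?_, by simp [Set.inter_comm], ?_⟩
  · rw [← t.inv_nhdsOne]
    exact inv_mem_inv hVW
  · exact (Set.mul_subset_mul (fun x hx => hx.1.1) fun x hx => hx.1.2).trans h

section Normal

variable (N : Subgroup G) [N.Normal]

/-- The preimage on `G` of a group topology on the quotient. -/
def comapMk (t : GroupTopology (G ⧸ N)) : GroupTopology G where
  toTopologicalSpace := t.toTopologicalSpace.induced (QuotientGroup.mk' N)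
  toIsTopologicalGroup :=
    let := t.toTopologicalSpace
    haveI := t.toIsTopologicalGroup
    topologicalGroup_induced (QuotientGroup.mk' N)

theorem nhdsOne_comapMk (t : GroupTopology (G ⧸ N)) :
    (comapMk N t).nhdsOne = comap (QuotientGroup.mk' N) t.nhdsOne := by
  refine (@nhds_induced _ _ t.toTopologicalSpace _ _).trans ?_
  rw [map_one]
  rfl

/-- The group topology in which the normal subgroup `N` is the least neighbourhood of `1`. -/
def ofNormal : GroupTopology G := comapMk N ⊥

theorem nhdsOne_ofNormal : (ofNormal N).nhdsOne = 𝓟 (N : Set G) := by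
  have : (⊥ : GroupTopology (G ⧸ N)).nhdsOne = 𝓟 {1} :=
    (congrFun (@nhds_discrete _ ⊥ (discreteTopology_bot _)) 1).trans (principal_singleton 1).symm
  rw [ofNormal, nhdsOne_comapMk, this, comap_principal]
  congr 1
  ext x
  simp

theorem comapMk_le_comapMk {s t : GroupTopology (G ⧸ N)} :
    comapMk N s ≤ comapMk N t ↔ s ≤ t := by
  rw [← nhdsOne_le_iff, ← nhdsOne_le_iff, nhdsOne_comapMk, nhdsOne_comapMk]
  refine ⟨fun h => ?_, fun h => comap_mono h⟩
  have := map_mono (m := QuotientGroup.mk' N) h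
  rwa [map_comap_of_surjective (QuotientGroup.mk'_surjective N),
    map_comap_of_surjective (QuotientGroup.mk'_surjective N)] at this

theorem ofNormal_le_comapMk (t : GroupTopology (G ⧸ N)) : ofNormal N ≤ comapMk N t :=
  comapMk_le_comapMk N (s := ⊥) |>.2 bot_le

theorem exists_comapMk_eq {t : GroupTopology G} (ht : ofNormal N ≤ t) :
    ∃ s, comapMk N s = t := by
  have hN : 𝓟 (N : Set G) ≤ t.nhdsOne := by
    rw [← nhdsOne_ofNormal]
    exact nhdsOne_le_iff.2 ht
  obtain ⟨s, hs⟩ : ∃ s : GroupTopology (G ⧸ N),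
      s.nhdsOne = map (QuotientGroup.mk' N) t.nhdsOne := by
    refine exists_nhdsOne_eq ?_ ?_ ?_ ?_
    · rw [← Filter.map_one (QuotientGroup.mk' N)]
      exact map_mono t.one_le_nhdsOne
    · rw [← Filter.map_mul]
      exact map_mono t.nhdsOne_mul_nhdsOne
    · rw [← Filter.map_inv' (QuotientGroup.mk' N), t.inv_nhdsOne]
    · intro q
      obtain ⟨g, rfl⟩ := QuotientGroup.mk'_surjective N q
      refine le_trans (le_of_eq ?_) (map_mono (t.map_conj_nhdsOne g))
      rw [map_map, map_map]
      congr 1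
  refine ⟨s, le_antisymm (nhdsOne_le_iff.1 ?_) (nhdsOne_le_iff.1 ?_)⟩ <;>
    rw [nhdsOne_comapMk, hs]
  · intro U hU
    obtain ⟨V, hV, -, hVU⟩ := exists_mul_subset hU
    refine mem_comap.2 ⟨_, image_mem_map hV, ?_⟩
    rintro x ⟨v, hv, hvx⟩
    have hn : v⁻¹ * x ∈ N := QuotientGroup.eq.1 hvx
    exact hVU ⟨v, hv, v⁻¹ * x, hN hV hn, by group⟩
  · exact le_comap_map

/-- The lattice of group topologies on the quotient as a principal ideal in that on `G`. -/
def comapMkEmbedding : GroupTopologyLattice (G ⧸ N) ↪o GroupTopologyLattice G :=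
  (OrderEmbedding.ofMapLEIff (comapMk N) fun _ _ => comapMk_le_comapMk N).dual

theorem range_comapMkEmbedding :
    Set.range (comapMkEmbedding N) = Set.Iic (OrderDual.toDual (ofNormal N)) := by
  ext t
  refine ⟨?_, fun ht => exists_comapMk_eq N (t := OrderDual.ofDual t) ht⟩
  rintro ⟨s, rfl⟩
  exact ofNormal_le_comapMk N s

theorem nhdsOne_sup_ofNormal (t : GroupTopology G) :
    (t ⊔ ofNormal N).nhdsOne = t.nhdsOne * 𝓟 (N : Set G) := by
  rw [nhdsOne_sup, nhdsOne_ofNormal]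
  rw [nhdsOne_ofNormal]
  intro U hU
  obtain ⟨V, hV, W, hW, h⟩ := mem_mul.1 hU
  refine mem_mul.2 ⟨N, mem_principal_self _, V, hV, ?_⟩
  rintro _ ⟨n, hn, v, hv, rfl⟩
  have hn' : v⁻¹ * n * v ∈ N := by
    simpa using ‹N.Normal›.conj_mem n hn v⁻¹
  exact h ⟨v, hv, v⁻¹ * n * v, hW hn', by group⟩

theorem mem_nhdsOne_sup_ofNormal {t : GroupTopology G} {U : Set G} :
    U ∈ (t ⊔ ofNormal N).nhdsOne ↔ ∃ V ∈ t.nhdsOne, V * (N : Set G) ⊆ U := by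
  rw [nhdsOne_sup_ofNormal, mem_mul]
  exact ⟨fun ⟨V, hV, W, hW, h⟩ => ⟨V, hV, (Set.mul_subset_mul_left hW).trans h⟩,
    fun ⟨V, hV, h⟩ => ⟨V, hV, N, mem_principal_self _, h⟩⟩

/-- A group topology is determined among the finer ones by its traces on `N` and on `G ⧸ N`. -/
theorem le_of_le_sup_ofNormal {s t : GroupTopology G} (hst : s ≤ t)
    (hsup : t ≤ s ⊔ ofNormal N) (hinf : t ⊓ ofNormal N ≤ s) : t ≤ s := by
  rw [← nhdsOne_le_iff] at *
  intro U hU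
  obtain ⟨V, hV, -, hVU⟩ := exists_mul_subset hU
  have hV' := hinf hV
  rw [nhdsOne_inf, nhdsOne_ofNormal, mem_inf_principal] at hV'
  obtain ⟨W, hW, hWinv, hWV⟩ := exists_mul_subset hV'
  have hVWN : V ∩ W * (N : Set G) ∈ t.nhdsOne :=
    hsup ((mem_nhdsOne_sup_ofNormal N).2 ⟨_, inter_mem hV (hst hW), subset_rfl⟩)
  filter_upwards [hVWN, hW]
  rintro _ ⟨v, ⟨hv, hvW⟩, n, hn, rfl⟩ hx
  -- Both `v` and `v * n` lie in `W`, so `n ∈ W * W ∩ N ⊆ V`.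
  refine hVU ⟨v, hv, n, hWV ⟨v⁻¹, ?_, v * n, hx, by group⟩ hn, rfl⟩
  rwa [← Set.mem_inv, hWinv]

/-- Neighbourhoods for `d` absorb `N`: if `a * n` is `d`-small, then so is `a`. -/
theorem sup_ofNormal_inf_le {s d : GroupTopology G} (hd : ofNormal N ≤ d) :
    (s ⊔ ofNormal N) ⊓ d ≤ (s ⊓ d) ⊔ ofNormal N := by
  rw [← nhdsOne_le_iff]
  intro U hU
  obtain ⟨V, hV, hVU⟩ := (mem_nhdsOne_sup_ofNormal N).1 hU
  rw [nhdsOne_inf, mem_inf_iff_superset] at hV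
  obtain ⟨A, hA, D, hD, hAD⟩ := hV
  obtain ⟨E, hE, -, hED⟩ := exists_mul_subset hD
  have hNE : (N : Set G) ⊆ E := by
    have := nhdsOne_le_iff.2 hd hE
    rwa [nhdsOne_ofNormal, mem_principal] at this
  rw [nhdsOne_inf]
  have hAN := (mem_nhdsOne_sup_ofNormal N).2 ⟨A, hA, subset_rfl⟩
  filter_upwards [mem_inf_of_left hAN, mem_inf_of_right hE]
  rintro _ ⟨a, ha, n, hn, rfl⟩ hx
  refine hVU ⟨a, hAD ⟨ha, hED ⟨a * n, hx, n⁻¹, hNE (N.inv_mem hn), by group⟩⟩, n, hn, rfl⟩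

end Normal

/-- Modulo a central subgroup, comparable neighbourhood filters commute. -/
theorem nhdsOne_mul_comm_of_le_center {N : Subgroup G} [N.Normal] (hN : N ≤ Subgroup.center G)
    {a y : GroupTopology G} (h : y ≤ a ⊔ ofNormal N) :
    a.nhdsOne * y.nhdsOne ≤ y.nhdsOne * a.nhdsOne := by
  intro S hS
  obtain ⟨Y, hY, U, hU, hYU⟩ := mem_mul.1 hS
  obtain ⟨V, hV, -, hVU⟩ := exists_mul_subset hU
  obtain ⟨W, hW, hWinv, hWV⟩ := exists_mul_subset hV
  have hWN : W * (N : Set G) ∈ y.nhdsOne :=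
    nhdsOne_le_iff.2 h ((mem_nhdsOne_sup_ofNormal N).2 ⟨W, hW, subset_rfl⟩)
  -- Elements of `W * N` conjugate like elements of `W`, since `N` is central; so conjugating by
  -- them keeps `W` inside `U`.
  refine mem_mul.2 ⟨W, hW, Y ∩ (W * N), inter_mem hY hWN, ?_⟩
  rintro _ ⟨u, hu, _, ⟨hy, w, hw, n, hn, rfl⟩, rfl⟩
  have hw' : w⁻¹ ∈ W := by rwa [← Set.mem_inv, hWinv]
  have hWV' : W ⊆ V := fun x hx => hWV ⟨x, hx, 1, a.one_le_nhdsOne hW, mul_one x⟩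
  refine hYU ⟨w * n, hy, w⁻¹ * u * w,
    hVU ⟨w⁻¹ * u, hWV ⟨w⁻¹, hw', u, hu, rfl⟩, w, hWV' hw, rfl⟩, ?_⟩
  have hc := Subgroup.mem_center_iff.1 (hN hn)
  calc w * n * (w⁻¹ * u * w) = w * (n * (w⁻¹ * u * w)) := by group
    _ = w * ((w⁻¹ * u * w) * n) := by rw [hc]
    _ = u * (w * n) := by group

/-- By commutation, `y ⊔ a` has neighbourhoods `Z * U`. If `w * u` and `w` are both `c`-small, so is
`u`, and `a ⊓ c ≤ y` makes `u` small for `y`. -/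
theorem sup_inf_le_of_le_center {N : Subgroup G} [N.Normal] (hN : N ≤ Subgroup.center G)
    {a y c : GroupTopology G} (h : y ≤ a ⊔ ofNormal N) (hyc : y ≤ c) (hac : a ⊓ c ≤ y) :
    (y ⊔ a) ⊓ c ≤ y := by
  rw [← nhdsOne_le_iff, nhdsOne_inf, nhdsOne_sup (nhdsOne_mul_comm_of_le_center hN h)]
  intro Y hY
  obtain ⟨Z, hZ, -, hZY⟩ := exists_mul_subset hY
  have hZ' := nhdsOne_le_iff.2 hac hZ
  rw [nhdsOne_inf, mem_inf_iff_superset] at hZ'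
  obtain ⟨U, hU, V, hV, hUV⟩ := hZ'
  obtain ⟨W, hW, hWinv, hWV⟩ := exists_mul_subset hV
  have hZW : Z ∩ W ∈ y.nhdsOne := inter_mem hZ (nhdsOne_le_iff.2 hyc hW)
  filter_upwards [mem_inf_of_left (mul_mem_mul hZW hU), mem_inf_of_right hW]
  rintro _ ⟨w, ⟨hwZ, hwW⟩, u, hu, rfl⟩ hx
  refine hZY ⟨w, hwZ, u, hUV ⟨hu, hWV ⟨w⁻¹, ?_, w * u, hx, by group⟩⟩, rfl⟩
  rwa [← Set.mem_inv, hWinv]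

end GroupTopology

theorem theorem2 {G : Type*} [Group G] (N : Subgroup G) (hN : N ≤ Subgroup.center G) :
    haveI : N.Normal := Subgroup.normal_of_central hN
    IsSemimodularLattice (GroupTopologyLattice G) ↔
      IsSemimodularLattice (GroupTopologyLattice (G ⧸ N)) := by
  have : N.Normal := Subgroup.normal_of_central hN
  rw [isSemimodularLattice_iff_of_range_eq_Iic _ (GroupTopology.range_comapMkEmbedding N)]
  refine ⟨fun h a b c _ _ _ hba => isSemimodularLattice_iff_wcovBy.1 h a b hba c,
    isSemimodularLattice_of_Iic ?_ ?_ ?_⟩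
  -- The order dual swaps `⊔` and `⊓`, so the topological lemmas are the three lattice laws read
  -- upside down.
  · exact fun x y hxy h h' => GroupTopology.le_of_le_sup_ofNormal N
      (s := OrderDual.ofDual y) (t := OrderDual.ofDual x) hxy h h'
  · exact fun x d hd => GroupTopology.sup_ofNormal_inf_le N
      (s := OrderDual.ofDual x) (d := OrderDual.ofDual d) hd
  · exact fun a y c h hcy hya => GroupTopology.sup_inf_le_of_le_center hN
      (a := OrderDual.ofDual a) (y := OrderDual.ofDual y) (c := OrderDual.ofDual c) h hcy hya
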